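/- Let $D=D([0,\infty);\mathbb R^d)$ be the space of right-continuous paths with left limits, with Skorohod's $J_1$-topology and its Borel $\sigma$-algebra. Let $A_n$ ($n\in\mathbb N$) and $A$ be $D$-valued random elements, possibly defined on different probability spaces $(\Omega_n,\mathcal F_n,P_n)$ and $(\Omega',\mathcal F',P')$. Assume that almost surely every coordinate of $A_n$ is nondecreasing in $t$, that $A$ has almost surely continuous paths, and that the finite-dimensional distributions of $A_n$ converge weakly to those of $A$, i.e. $(A_n(t_1),\dots,A_n(t_k))$ converges in law to $(A(t_1),\dots,A(t_k))$ for all $k$ and all $t_1,\dots,t_k\ge 0$. Then: 1. The sequence $A_n$ is $C$-tight: for every $T\ge 0$, $\lim_{K\to\infty}\sup_n P_n\big(\sup_{t\le T}|A_n(t)|>K\big)=0$, and for every $T\ge 0$ and $\varepsilon>0$, $$\lim_{\delta\downarrow 0}\ \limsup_{n\to\infty}\ P_n\big(\omega_C(A_n,\delta,T)\ge\varepsilon\big)=0,\qquad \omega_C(x,\delta,T)=\sup_{s,t\in[0,T],\ |t-s|<\delta}|x(t)-x(s)|.$$ 2. $A_n$ converges weakly to $A$ in the $C$-topology, that is, the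 topology on $D$ of uniform convergence on compact time sets: $E f(A_n)\to E f(A)$ for every bounded measurable $f:D\to\mathbb R$ that is continuous for this topology. 3. $A_n$ converges weakly to $A$ in the $J_1$-topology on $D$. -/

import Mathlib

open MeasureTheory ProbabilityTheory Filter Topology
open scoped NNReal ENNReal

/-- The space `D[0,∞)` of `ℝ^d`-valued càdlàg paths: right-continuous paths on `[0,∞)` which have
left limits everywhere. -/
structure SkorokhodSpace (d : ℕ) where
  toFun : ℝ≥0 → EuclideanSpace ℝ (Fin d)
  right_continuous : ∀ t, ContinuousWithinAt toFun (Set.Ici t) t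
  left_limits : ∀ t, ∃ l, Tendsto toFun (𝓝[<] t) (𝓝 l)

namespace SkorokhodSpace

variable {d : ℕ}

instance : CoeFun (SkorokhodSpace d) (fun _ => ℝ≥0 → EuclideanSpace ℝ (Fin d)) := ⟨toFun⟩

/-- The basic Skorokhod neighbourhood of `x`: the paths `y` for which some time change `lam`
(an increasing bijection of `[0,∞)`) satisfies `sup_t |lam t - t| ≤ ε` and
`sup_{t ≤ T} |y (lam t) - x t| ≤ ε`. -/
def j1Nhd (x : SkorokhodSpace d) (ε : ℝ) (T : ℝ≥0) : Set (SkorokhodSpace d) :=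
  {y | ∃ lam : ℝ≥0 ≃o ℝ≥0, (∀ t, dist (lam t) t ≤ ε) ∧ ∀ t ≤ T, dist (y (lam t)) (x t) ≤ ε}

theorem j1Nhd_mono (x : SkorokhodSpace d) {ε ε' : ℝ} {T T' : ℝ≥0} (hε : ε ≤ ε') (hT : T' ≤ T) :
    x.j1Nhd ε T ⊆ x.j1Nhd ε' T' := by
  rintro y ⟨lam, h1, h2⟩
  exact ⟨lam, fun t => (h1 t).trans hε, fun t ht => (h2 t (ht.trans hT)).trans hε⟩

/-- Skorokhod's `J₁` topology on `D[0,∞)`. A sequence `x_n` converges to `x` iff there are time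
changes `lam_n` with `sup_t |lam_n t - t| → 0` and `sup_{t ≤ T} |x_n (lam_n t) - x t| → 0` for
every `T`. -/
instance : TopologicalSpace (SkorokhodSpace d) where
  IsOpen U := ∀ x ∈ U, ∃ ε > 0, ∃ T : ℝ≥0, x.j1Nhd ε T ⊆ U
  isOpen_univ := fun _ _ => ⟨1, one_pos, 0, Set.subset_univ _⟩
  isOpen_inter := by
    rintro U V hU hV x ⟨hxU, hxV⟩
    obtain ⟨ε, hε, T, h⟩ := hU x hxU
    obtain ⟨ε', hε', T', h'⟩ := hV x hxV
    exact ⟨min ε ε', lt_min hε hε', max T T', Set.subset_inter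
      ((x.j1Nhd_mono (min_le_left _ _) (le_max_left _ _)).trans h)
      ((x.j1Nhd_mono (min_le_right _ _) (le_max_right _ _)).trans h')⟩
  isOpen_sUnion := by
    rintro S hS x ⟨U, hU, hxU⟩
    obtain ⟨ε, hε, T, h⟩ := hS U hU x hxU
    exact ⟨ε, hε, T, h.trans (Set.subset_sUnion_of_mem hU)⟩

/-- The Borel σ-algebra of the `J₁` topology. -/
instance : MeasurableSpace (SkorokhodSpace d) := borel _

instance : BorelSpace (SkorokhodSpace d) := ⟨rfl⟩

/-- The `C`-topology on `D[0,∞)`: uniform convergence on compact time sets. -/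
@[reducible] def cTopology (d : ℕ) : TopologicalSpace (SkorokhodSpace d) :=
  TopologicalSpace.induced
    (fun x => UniformOnFun.ofFun {K : Set ℝ≥0 | IsCompact K} x.toFun) inferInstance

/-- The modulus of continuity
`ω_C(x, δ, T) = sup {|x t - x s| : s, t ∈ [0, T], |t - s| < δ}`, with values in `[0, ∞]`. -/
noncomputable def modulusC (x : SkorokhodSpace d) (δ : ℝ) (T : ℝ≥0) : ℝ≥0∞ :=
  ⨆ (s : ℝ≥0) (t : ℝ≥0) (_ : s ≤ T) (_ : t ≤ T) (_ : dist t s < δ), edist (x t) (x s)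

end SkorokhodSpace

/-- Convergence of the finite-dimensional distributions of `X n` to those of `Y`: for all times
`t_1, …, t_k`, the vector `(X n (t_1), …, X n (t_k))` converges in law to
`(Y (t_1), …, Y (t_k))`. -/
def FDDConverges {d : ℕ} {Ω : ℕ → Type*} {Ω' : Type*} [∀ n, MeasurableSpace (Ω n)]
    [MeasurableSpace Ω'] (P : ∀ n, Measure (Ω n)) [∀ n, IsProbabilityMeasure (P n)]
    (P' : Measure Ω') [IsProbabilityMeasure P']
    (X : ∀ n, Ω n → SkorokhodSpace d) (Y : Ω' → SkorokhodSpace d) : Prop :=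
  ∀ (k : ℕ) (t : Fin k → ℝ≥0),
    TendstoInDistribution (fun n ω i => X n ω (t i)) atTop (fun ω i => Y ω (t i)) P P'

/-- `C`-tightness of a sequence of `D`-valued processes: the running maxima of `|X n|` are tight on
each `[0, T]`, and for all `T` and `ε > 0`,
`lim_{δ → 0} limsup_n P (ω_C(X n, δ, T) ≥ ε) = 0`. -/
def CTight {d : ℕ} {Ω : ℕ → Type*} [∀ n, MeasurableSpace (Ω n)] (P : ∀ n, Measure (Ω n))
    (X : ∀ n, Ω n → SkorokhodSpace d) : Prop :=
  (∀ T : ℝ≥0, ∀ η : ℝ≥0∞, 0 < η → ∃ K : ℝ, ∀ n, P n {ω | ∃ t ≤ T, K < ‖X n ω t‖} ≤ η) ∧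
  ∀ T : ℝ≥0, ∀ ε : ℝ≥0∞, 0 < ε →
    Tendsto (fun δ : ℝ => limsup (fun n => P n {ω | ε ≤ (X n ω).modulusC δ T}) atTop)
      (𝓝[>] 0) (𝓝 0)

/-- Weak convergence in the `C`-topology: `E f(X n) → E f(Y)` for every bounded measurable
functional `f` on `D` which is continuous for uniform convergence on compact time sets. (The
`C`-topology is not separable on `D`, so measurability of `f` has to be required: it refers to the
σ-algebra that carries the laws.) -/
def WeakConvergesC {d : ℕ} {Ω : ℕ → Type*} {Ω' : Type*} [∀ n, MeasurableSpace (Ω n)]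
    [MeasurableSpace Ω'] (P : ∀ n, Measure (Ω n)) (P' : Measure Ω')
    (X : ∀ n, Ω n → SkorokhodSpace d) (Y : Ω' → SkorokhodSpace d) : Prop :=
  ∀ f : SkorokhodSpace d → ℝ, Measurable f → Continuous[SkorokhodSpace.cTopology d, _] f →
    (∃ C, ∀ x, |f x| ≤ C) →
    Tendsto (fun n => ∫ ω, f (X n ω) ∂(P n)) atTop (𝓝 (∫ ω, f (Y ω) ∂P'))

/-! For a path with nondecreasing coordinates, the increment between two times is dominated in norm
by the increment over any larger interval. The finitely many values on a grid therefore control the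
whole path on `[0, L]`: the path stays within `gridOsc` of its step interpolation
(`dist_gridStep_le_gridOsc_of_monotone`), and its modulus at the scale of the mesh is at most `2 *
gridOsc`. Since `gridOsc` is a continuous function of the grid values, it converges in law along `A
n`, and for the continuous limit it tends to 0 with the mesh. This gives `C`-tightness.

For weak convergence, replace `f` by its inf-convolution `lowerReg f L`, which is `L`-Lipschitz and
converges to `f` pointwise on `D` by `C`-continuity. Evaluated at the step interpolation and lowered
by the Lipschitz error, it becomes `gridMinorant`: a bounded continuous function of grid values that
lies below `f` on monotone paths. Convergence of the marginals bounds `liminf E f(A n)` below by the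
expectation of `gridMinorant` for the limit, which tends to `E f(A')` as first the mesh tends to 0,
then `L → ∞`. The same bound for `-f` gives equality. -/

/-! ### Grids and step interpolation -/

section Grid

/-- The grid point `j / (m + 1)`. -/
noncomputable def gridTime (m j : ℕ) : ℝ≥0 := j / (m + 1)

/-- The last index of the grid of mesh `1 / (m + 1)` on `[0, L + 2]`. -/
def gridSize (L m : ℕ) : ℕ := (L + 2) * (m + 1)

/-- The index of the grid cell which contains `t`. -/
noncomputable def gridIndex (L m : ℕ) (t : ℝ≥0) : Fin (gridSize L m + 1) :=
  ⟨min ⌊t * (m + 1)⌋₊ (gridSize L m), Nat.lt_succ_of_le (min_le_right _ _)⟩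

/-- The values of a path at the grid points in `[0, L + 2]`. -/
noncomputable def gridSample {E : Type*} (L m : ℕ) (x : ℝ≥0 → E) (j : Fin (gridSize L m + 1)) : E :=
  x (gridTime m j)

/-- The step function with prescribed values at the grid points. -/
noncomputable def gridStep {E : Type*} (L m : ℕ) (v : Fin (gridSize L m + 1) → E) (t : ℝ≥0) : E :=
  v (gridIndex L m t)

/-- The largest increment between neighbouring grid points. -/
noncomputable def gridOsc {E : Type*} [NormedAddCommGroup E] (L m : ℕ)
    (v : Fin (gridSize L m + 1) → E) : ℝ :=
  ‖fun j : Fin (gridSize L m) => v j.succ - v j.castSucc‖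

theorem gridTime_floor_le (m : ℕ) (t : ℝ≥0) : gridTime m ⌊t * (m + 1)⌋₊ ≤ t := by
  rw [gridTime, div_le_iff₀ (by positivity)]
  exact Nat.floor_le (by positivity)

theorem lt_gridTime_floor_succ (m : ℕ) (t : ℝ≥0) : t < gridTime m (⌊t * (m + 1)⌋₊ + 1) := by
  rw [gridTime, lt_div_iff₀ (by positivity)]
  exact_mod_cast Nat.lt_floor_add_one (t * (m + 1))

theorem gridTime_succ (m j : ℕ) : gridTime m (j + 1) = gridTime m j + 1 / (m + 1) := by
  simp only [gridTime]; push_cast; rw [add_div]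

theorem gridTime_le {L m j : ℕ} (h : j ≤ gridSize L m) : gridTime m j ≤ L + 2 := by
  rw [gridTime, div_le_iff₀ (by positivity)]
  exact_mod_cast h

/-- The extra length 2 of the grid leaves room for the two grid points that follow the cell of `t`.
-/
theorem floor_add_two_le_gridSize {L m : ℕ} {t : ℝ≥0} (ht : t ≤ L) :
    ⌊t * (m + 1)⌋₊ + 2 ≤ gridSize L m := by
  have : ⌊t * (m + 1)⌋₊ ≤ L * (m + 1) := by
    rw [← Nat.floor_natCast (R := ℝ≥0) (L * (m + 1))]
    refine Nat.floor_mono ?_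
    push_cast; gcongr
  rw [gridSize]; nlinarith

theorem gridStep_gridSample {E : Type*} {L m : ℕ} (x : ℝ≥0 → E) {t : ℝ≥0} (ht : t ≤ L) :
    gridStep L m (gridSample L m x) t = x (gridTime m ⌊t * (m + 1)⌋₊) := by
  have := floor_add_two_le_gridSize (m := m) ht
  simp only [gridStep, gridSample, gridIndex]
  rw [min_eq_left (by omega)]

variable {E : Type*} [NormedAddCommGroup E] {L m : ℕ}

theorem norm_sub_le_gridOsc (x : ℝ≥0 → E) {j : ℕ} (hj : j < gridSize L m) :
    ‖x (gridTime m (j + 1)) - x (gridTime m j)‖ ≤ gridOsc L m (gridSample L m x) :=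
  norm_le_pi_norm (fun j : Fin (gridSize L m) =>
    gridSample L m x j.succ - gridSample L m x j.castSucc) ⟨j, hj⟩

theorem gridOsc_nonneg (v : Fin (gridSize L m + 1) → E) : 0 ≤ gridOsc L m v := norm_nonneg _

theorem continuous_gridOsc : Continuous (gridOsc (E := E) L m) := by
  unfold gridOsc; fun_prop

theorem dist_gridStep_le (v w : Fin (gridSize L m + 1) → E) (t : ℝ≥0) :
    dist (gridStep L m v t) (gridStep L m w t) ≤ dist v w :=
  dist_le_pi_dist v w _

theorem eventually_dist_le_of_continuous {x : ℝ≥0 → E} (hx : Continuous x) (T : ℝ≥0) {ε : ℝ}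
    (hε : 0 < ε) : ∀ᶠ m : ℕ in atTop, ∀ s t, s ≤ T → t ≤ T → dist s t ≤ 1 / (m + 1) →
      dist (x s) (x t) < ε := by
  have hu : UniformContinuousOn x (Set.Icc 0 T) :=
    isCompact_Icc.uniformContinuousOn_of_continuous hx.continuousOn
  obtain ⟨δ, hδ, h⟩ := Metric.uniformContinuousOn_iff.1 hu ε hε
  filter_upwards [(tendsto_one_div_add_atTop_nhds_zero_nat (𝕜 := ℝ)).eventually_lt_const hδ]
    with m hm s t hs ht hst
  exact h s ⟨zero_le, hs⟩ t ⟨zero_le, ht⟩ (hst.trans_lt hm)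

theorem tendsto_gridOsc_gridSample {x : ℝ≥0 → E} (hx : Continuous x) (L : ℕ) :
    Tendsto (fun m => gridOsc L m (gridSample L m x)) atTop (𝓝 0) := by
  rw [Metric.tendsto_nhds]
  intro ε hε
  filter_upwards [eventually_dist_le_of_continuous hx (L + 2) hε] with m hm
  rw [Real.dist_eq, sub_zero, abs_of_nonneg (gridOsc_nonneg _), gridOsc, pi_norm_lt_iff hε]
  intro j
  rw [← dist_eq_norm]
  refine hm _ _ (gridTime_le j.succ.is_le) (gridTime_le j.castSucc.is_le) ?_
  simp only [Fin.val_succ, Fin.val_castSucc, gridTime_succ]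
  rw [NNReal.dist_eq]; push_cast; simp only [add_sub_cancel_left]
  rw [abs_of_nonneg (by positivity)]

theorem eventually_dist_gridStep_le {x : ℝ≥0 → E} (hx : Continuous x) (L : ℕ) {ε : ℝ}
    (hε : 0 < ε) : ∀ᶠ m : ℕ in atTop, ∀ t : ℝ≥0, t ≤ L →
      dist (x t) (gridStep L m (gridSample L m x) t) ≤ ε := by
  filter_upwards [eventually_dist_le_of_continuous hx L hε] with m hm t ht
  rw [gridStep_gridSample x ht]
  refine (hm _ _ ht ((gridTime_floor_le m t).trans ht) ?_).le
  have h1 := gridTime_floor_le m t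
  have h2 := (lt_gridTime_floor_succ m t).le
  rw [gridTime_succ] at h2
  rw [NNReal.dist_eq, abs_of_nonneg (sub_nonneg.2 (by exact_mod_cast h1)), sub_le_iff_le_add']
  exact_mod_cast h2

end Grid

/-! ### Monotone paths are controlled by their grid values -/

section Monotone

variable {d L m : ℕ} {x : ℝ≥0 → EuclideanSpace ℝ (Fin d)}

/-- In each coordinate the inner increment lies between 0 and the outer one, and the Euclidean norm
is monotone on nonnegative vectors. -/
theorem norm_sub_le_of_monotone (hx : ∀ i, Monotone fun t => x t i) {a s t b : ℝ≥0}
    (has : a ≤ s) (hst : s ≤ t) (htb : t ≤ b) : ‖x t - x s‖ ≤ ‖x b - x a‖ := by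
  rw [EuclideanSpace.norm_eq, EuclideanSpace.norm_eq]
  refine Real.sqrt_le_sqrt (Finset.sum_le_sum fun i _ => ?_)
  have h1 := hx i has
  have h2 := hx i hst
  have h3 := hx i htb
  simp only [PiLp.sub_apply, Real.norm_eq_abs] at *
  refine pow_le_pow_left₀ (abs_nonneg _) ?_ 2
  rw [abs_of_nonneg (by linarith), abs_of_nonneg (by linarith)]
  linarith

theorem norm_le_of_monotone (hx : ∀ i, Monotone fun t => x t i) {t T : ℝ≥0} (ht : t ≤ T) :
    ‖x t‖ ≤ ‖x T - x 0‖ + ‖x 0‖ := by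
  have h1 := norm_sub_le_of_monotone hx le_rfl (zero_le (a := t)) ht
  have h2 := norm_le_norm_sub_add (x t) (x 0)
  linarith

theorem dist_gridStep_le_gridOsc_of_monotone (hx : ∀ i, Monotone fun t => x t i) {t : ℝ≥0}
    (ht : t ≤ L) : dist (x t) (gridStep L m (gridSample L m x) t) ≤
      gridOsc L m (gridSample L m x) := by
  have := floor_add_two_le_gridSize (m := m) ht
  rw [gridStep_gridSample x ht, dist_eq_norm]
  exact (norm_sub_le_of_monotone hx le_rfl (gridTime_floor_le m t)
    (lt_gridTime_floor_succ m t).le).trans (norm_sub_le_gridOsc x (by omega))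

theorem dist_le_gridOsc_of_monotone (hx : ∀ i, Monotone fun t => x t i) {s t : ℝ≥0}
    (hs : s ≤ L) (ht : t ≤ L) (hst : dist t s < 1 / (m + 1)) :
    dist (x t) (x s) ≤ 2 * gridOsc L m (gridSample L m x) := by
  wlog h : s ≤ t generalizing s t
  · rw [dist_comm]
    exact this ht hs (by rwa [dist_comm]) (le_of_not_ge h)
  have hL := floor_add_two_le_gridSize (m := m) hs
  have h1 := lt_gridTime_floor_succ m s
  -- As `t - s` is below the mesh, `t` is at most one cell beyond that of `s`; these two cells give
  -- the factor 2.
  have h2 : t ≤ gridTime m (⌊s * (m + 1)⌋₊ + 1 + 1) := by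
    rw [gridTime_succ]
    rw [NNReal.dist_eq, abs_of_nonneg (sub_nonneg.2 (by exact_mod_cast h)),
      sub_lt_iff_lt_add'] at hst
    have : t < s + 1 / (m + 1) := by exact_mod_cast hst
    exact this.le.trans (by gcongr)
  rw [dist_eq_norm]
  refine (norm_sub_le_of_monotone hx (gridTime_floor_le m s) h h2).trans ?_
  have h3 := norm_sub_le_gridOsc (L := L) (m := m) x (j := ⌊s * (m + 1)⌋₊) (by omega)
  have h4 := norm_sub_le_gridOsc (L := L) (m := m) x (j := ⌊s * (m + 1)⌋₊ + 1) (by omega)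
  have h5 := norm_sub_le_norm_sub_add_norm_sub (x (gridTime m (⌊s * (m + 1)⌋₊ + 1 + 1)))
    (x (gridTime m (⌊s * (m + 1)⌋₊ + 1))) (x (gridTime m ⌊s * (m + 1)⌋₊))
  linarith

theorem modulusC_le_gridOsc_of_monotone (x : SkorokhodSpace d)
    (hx : ∀ i, Monotone fun t => x t i) {δ : ℝ} (hδ : δ ≤ 1 / (m + 1)) {T : ℝ≥0} (hT : T ≤ L) :
    x.modulusC δ T ≤ ENNReal.ofReal (2 * gridOsc L m (gridSample L m x)) := by
  refine iSup_le fun s => iSup_le fun t => iSup_le fun hs => iSup_le fun ht => iSup_le fun h => ?_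
  rw [edist_dist]
  exact ENNReal.ofReal_le_ofReal
    (dist_le_gridOsc_of_monotone hx (hs.trans hT) (ht.trans hT) (h.trans_le hδ))

end Monotone

/-! ### Truncated uniform distance -/

section PathDist

variable {E : Type*} [PseudoMetricSpace E] {L : ℕ}

/-- The truncated uniform distance on `[0, L]`. -/
noncomputable def pathDist (L : ℕ) (x y : ℝ≥0 → E) : ℝ :=
  ⨆ t : Set.Iic (L : ℝ≥0), min 1 (dist (x t) (y t))

instance (L : ℕ) : Nonempty (Set.Iic (L : ℝ≥0)) := ⟨⟨L, Set.self_mem_Iic⟩⟩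

/-- The truncation at 1 keeps the real supremum bounded even for unbounded functions, where `⨆`
would otherwise default to 0. -/
theorem le_pathDist (x y : ℝ≥0 → E) {t : ℝ≥0} (ht : t ≤ L) :
    min 1 (dist (x t) (y t)) ≤ pathDist L x y :=
  le_ciSup (f := fun t : Set.Iic (L : ℝ≥0) => min 1 (dist (x t) (y t)))
    ⟨1, by rintro _ ⟨t, rfl⟩; exact min_le_left _ _⟩ ⟨t, ht⟩

theorem pathDist_nonneg (x y : ℝ≥0 → E) : 0 ≤ pathDist L x y :=
  (le_min zero_le_one dist_nonneg).trans (le_pathDist x y le_rfl)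

theorem pathDist_le_one (x y : ℝ≥0 → E) : pathDist L x y ≤ 1 :=
  ciSup_le fun _ => min_le_left _ _

theorem pathDist_le {x y : ℝ≥0 → E} {ε : ℝ} (h : ∀ t : ℝ≥0, t ≤ L → dist (x t) (y t) ≤ ε) :
    pathDist L x y ≤ min 1 ε :=
  ciSup_le fun t => min_le_min le_rfl (h t t.2)

theorem pathDist_self (x : ℝ≥0 → E) : pathDist L x x = 0 :=
  le_antisymm ((pathDist_le fun t _ => (dist_self (x t)).le).trans (min_le_right _ _))
    (pathDist_nonneg x x)

theorem pathDist_triangle (x y z : ℝ≥0 → E) :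
    pathDist L x z ≤ pathDist L x y + pathDist L y z := by
  refine ciSup_le fun t => ?_
  have h1 := le_pathDist x y t.2
  have h2 := le_pathDist y z t.2
  have h3 := dist_triangle (x t) (y t) (z t)
  have h4 := dist_nonneg (x := x t) (y := y t)
  have h5 := dist_nonneg (x := y t) (y := z t)
  refine le_trans ?_ (add_le_add h1 h2)
  simp only [min_def]
  split_ifs <;> linarith

end PathDist

/-! ### The `C`-topology and its comparison with `J₁` -/

namespace SkorokhodSpace

variable {d L : ℕ}

instance : Nonempty (SkorokhodSpace d) :=
  ⟨⟨fun _ => 0, fun _ => continuousWithinAt_const, fun _ => ⟨0, tendsto_const_nhds⟩⟩⟩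

theorem hasBasis_nhds_cTopology (x : SkorokhodSpace d) :
    (@nhds _ (cTopology d) x).HasBasis (fun p : Set ℝ≥0 × ℝ => IsCompact p.1 ∧ 0 < p.2)
      fun p => {y | ∀ t ∈ p.1, dist (y t) (x t) < p.2} := by
  rw [nhds_induced]
  exact (UniformOnFun.hasBasis_nhds_of_basis ℝ≥0 (EuclideanSpace ℝ (Fin d))
    {K : Set ℝ≥0 | IsCompact K} _ ⟨∅, isCompact_empty⟩
    (fun K hK K' hK' => ⟨K ∪ K', IsCompact.union hK hK', Set.subset_union_left,
      Set.subset_union_right⟩) Metric.uniformity_basis_dist).comap _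

theorem exists_forall_abs_sub_lt {f : SkorokhodSpace d → ℝ}
    (hf : Continuous[cTopology d, _] f) (x : SkorokhodSpace d) {ε : ℝ} (hε : 0 < ε) :
    ∃ T : ℝ≥0, ∃ δ > 0, ∀ y : SkorokhodSpace d, (∀ t ≤ T, dist (y t) (x t) < δ) →
      |f y - f x| < ε := by
  let _ := cTopology d
  obtain ⟨⟨K, δ⟩, ⟨hK, hδ⟩, h⟩ :=
    x.hasBasis_nhds_cTopology.mem_iff.1 (hf.continuousAt (Metric.ball_mem_nhds (f x) hε))
  obtain ⟨T, hT⟩ := IsCompact.bddAbove hK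
  exact ⟨T, δ, hδ, fun y hy => h fun t ht => hy t (hT ht)⟩

/-- The identity is an admissible time change, so each basic Skorokhod neighbourhood contains a
locally uniform one. -/
theorem cTopology_le : cTopology d ≤ (inferInstance : TopologicalSpace (SkorokhodSpace d)) := by
  intro U hU
  let _ := cTopology d
  refine isOpen_iff_mem_nhds.2 fun x hx => ?_
  obtain ⟨ε, hε, T, h⟩ := hU x hx
  refine x.hasBasis_nhds_cTopology.mem_iff.2 ⟨(Set.Icc 0 T, ε), ⟨isCompact_Icc, hε⟩, ?_⟩
  exact fun y hy => h ⟨OrderIso.refl _, fun t => by simpa using hε.le,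
    fun t ht => (hy t ⟨zero_le, ht⟩).le⟩

end SkorokhodSpace

/-! ### Inf-convolution and finite-dimensional minorants -/

section LowerReg

variable {d L : ℕ} {f : SkorokhodSpace d → ℝ} {C : ℝ}

/-- The Lipschitz regularization from below (inf-convolution) of a functional on path space. -/
noncomputable def lowerReg (f : SkorokhodSpace d → ℝ) (L : ℕ)
    (x : ℝ≥0 → EuclideanSpace ℝ (Fin d)) : ℝ :=
  ⨅ y : SkorokhodSpace d, f y + L * pathDist L x y

theorem lowerReg_le_add (hf : ∀ x, |f x| ≤ C) (x : ℝ≥0 → EuclideanSpace ℝ (Fin d))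
    (y : SkorokhodSpace d) : lowerReg f L x ≤ f y + L * pathDist L x y := by
  refine ciInf_le ⟨-C, ?_⟩ y
  rintro _ ⟨z, rfl⟩
  have := pathDist_nonneg (L := L) x z
  have := (abs_le.1 (hf z)).1
  have : 0 ≤ (L : ℝ) * pathDist L x z := by positivity
  simp only; linarith

theorem lowerReg_le (hf : ∀ x, |f x| ≤ C) (x : SkorokhodSpace d) : lowerReg f L x ≤ f x := by
  simpa [pathDist_self] using lowerReg_le_add (L := L) hf x x

theorem abs_lowerReg_le (hf : ∀ x, |f x| ≤ C) (x : ℝ≥0 → EuclideanSpace ℝ (Fin d)) :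
    |lowerReg f L x| ≤ C + L := by
  have hL : (0 : ℝ) ≤ L := Nat.cast_nonneg L
  refine abs_le.2 ⟨le_ciInf fun y => ?_, ?_⟩
  · have := mul_nonneg hL (pathDist_nonneg (L := L) x y)
    have := (abs_le.1 (hf y)).1
    linarith
  · obtain ⟨y⟩ := (inferInstance : Nonempty (SkorokhodSpace d))
    refine (lowerReg_le_add hf x y).trans (add_le_add (abs_le.1 (hf y)).2 ?_)
    exact mul_le_of_le_one_right hL (pathDist_le_one _ _)

/-- At a point of `D` the path itself competes in the infimum, so the bound is uniform in `L`, as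
dominated convergence for `L → ∞` requires. -/
theorem abs_lowerReg_coe_le (hf : ∀ x, |f x| ≤ C) (x : SkorokhodSpace d) :
    |lowerReg f L x| ≤ C := by
  refine abs_le.2 ⟨le_ciInf fun y => ?_, (lowerReg_le hf x).trans (abs_le.1 (hf x)).2⟩
  have := mul_nonneg (Nat.cast_nonneg L) (pathDist_nonneg (L := L) x y)
  have := (abs_le.1 (hf y)).1
  linarith

theorem lowerReg_le_lowerReg_add (hf : ∀ x, |f x| ≤ C) (x x' : ℝ≥0 → EuclideanSpace ℝ (Fin d)) :
    lowerReg f L x ≤ lowerReg f L x' + L * pathDist L x x' := by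
  rw [← sub_le_iff_le_add]
  refine le_ciInf fun y => ?_
  have h1 := lowerReg_le_add (L := L) hf x y
  have h2 := mul_le_mul_of_nonneg_left (pathDist_triangle (L := L) x x' y) (Nat.cast_nonneg L)
  linarith

/-- Competitors close to `x` on `[0, T]` have nearly the same value of `f`. For the others, once `L
≥ T`, the penalty is at least `L * min 1 δ`, which exceeds the oscillation `2 * C` of `f` when `L`
is large. -/
theorem tendsto_lowerReg (hf : ∀ x, |f x| ≤ C)
    (hc : Continuous[SkorokhodSpace.cTopology d, _] f) (x : SkorokhodSpace d) :
    Tendsto (fun L => lowerReg f L x) atTop (𝓝 (f x)) := by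
  refine tendsto_order.2 ⟨fun a ha => ?_, fun a ha =>
    .of_forall fun L => (lowerReg_le hf x).trans_lt ha⟩
  obtain ⟨T, δ, hδ, h⟩ := SkorokhodSpace.exists_forall_abs_sub_lt hc x
    (ε := (f x - a) / 2) (by linarith)
  have hδ' : 0 < min 1 δ := lt_min one_pos hδ
  filter_upwards [tendsto_natCast_atTop_atTop.eventually_ge_atTop T,
    (tendsto_natCast_atTop_atTop (R := ℝ)).eventually_ge_atTop (2 * C / min 1 δ)] with L hLT hLC
  refine lt_of_lt_of_le (show a < a + (f x - a) / 2 by linarith) (le_ciInf fun y => ?_)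
  have hnn : 0 ≤ (L : ℝ) * pathDist L x y := mul_nonneg (Nat.cast_nonneg L) (pathDist_nonneg _ _)
  by_cases hy : ∀ t ≤ T, dist (y t) (x t) < δ
  · have := (abs_lt.1 (h y hy)).1
    linarith
  · push Not at hy
    obtain ⟨t, ht, hyt⟩ := hy
    have h1 : min 1 δ ≤ pathDist L x y := by
      refine le_trans ?_ (le_pathDist x y (ht.trans hLT))
      rw [dist_comm] at hyt
      exact min_le_min le_rfl hyt
    rw [div_le_iff₀ hδ'] at hLC
    have h2 := mul_le_mul_of_nonneg_left h1 (Nat.cast_nonneg (α := ℝ) L)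
    have := (abs_le.1 (hf y)).1
    have := (abs_le.1 (hf x)).2
    linarith

/-- The finite-dimensional minorant of `f`: for monotone paths it lies below `f`. -/
noncomputable def gridMinorant (f : SkorokhodSpace d → ℝ) (L m : ℕ)
    (v : Fin (gridSize L m + 1) → EuclideanSpace ℝ (Fin d)) : ℝ :=
  lowerReg f L (gridStep L m v) - L * min 1 (gridOsc L m v)

theorem continuous_gridMinorant (hf : ∀ x, |f x| ≤ C) (L m : ℕ) :
    Continuous (gridMinorant f L m) := by
  refine Continuous.sub (LipschitzWith.continuous (K := L) (LipschitzWith.of_le_add_mul _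
    fun v w => ?_)) (continuous_const.mul (continuous_const.min continuous_gridOsc))
  refine (lowerReg_le_lowerReg_add hf _ (gridStep L m w)).trans ?_
  have := (pathDist_le (L := L) fun t _ => dist_gridStep_le v w t).trans (min_le_right _ _)
  simp only [NNReal.coe_natCast]
  gcongr

theorem abs_gridMinorant_le (hf : ∀ x, |f x| ≤ C) (L m : ℕ)
    (v : Fin (gridSize L m + 1) → EuclideanSpace ℝ (Fin d)) :
    |gridMinorant f L m v| ≤ C + L + L := by
  refine (abs_sub _ _).trans (add_le_add (abs_lowerReg_le hf _) ?_)
  have : 0 ≤ min 1 (gridOsc L m v) := le_min zero_le_one (gridOsc_nonneg v)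
  rw [abs_of_nonneg (by positivity)]
  exact mul_le_of_le_one_right (Nat.cast_nonneg L) (min_le_left _ _)

/-- Passing from the path to its step interpolation raises `lowerReg f L` by at most the subtracted
term. -/
theorem gridMinorant_le_of_monotone (hf : ∀ x, |f x| ≤ C) (L m : ℕ) (x : SkorokhodSpace d)
    (hx : ∀ i, Monotone fun t => x t i) :
    gridMinorant f L m (gridSample L m x) ≤ f x := by
  have h1 := lowerReg_le (L := L) hf x
  have h2 := lowerReg_le_lowerReg_add (L := L) hf (gridStep L m (gridSample L m x)) x
  have h3 : pathDist L (gridStep L m (gridSample L m x)) x ≤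
      min 1 (gridOsc L m (gridSample L m x)) := pathDist_le fun t ht => by
    rw [dist_comm]
    exact dist_gridStep_le_gridOsc_of_monotone hx ht
  have h4 := mul_le_mul_of_nonneg_left h3 (Nat.cast_nonneg (α := ℝ) L)
  rw [gridMinorant]
  linarith

theorem tendsto_gridMinorant (hf : ∀ x, |f x| ≤ C) (L : ℕ)
    {x : ℝ≥0 → EuclideanSpace ℝ (Fin d)} (hx : Continuous x) :
    Tendsto (fun m => gridMinorant f L m (gridSample L m x)) atTop (𝓝 (lowerReg f L x)) := by
  have h1 : Tendsto (fun m => pathDist L x (gridStep L m (gridSample L m x))) atTop (𝓝 0) := by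
    rw [Metric.tendsto_nhds]
    intro ε hε
    filter_upwards [eventually_dist_gridStep_le hx L (half_pos hε)] with m hm
    rw [Real.dist_eq, sub_zero, abs_of_nonneg (pathDist_nonneg _ _)]
    exact ((pathDist_le hm).trans (min_le_right _ _)).trans_lt (half_lt_self hε)
  have h2 : Tendsto (fun m => lowerReg f L (gridStep L m (gridSample L m x))) atTop
      (𝓝 (lowerReg f L x)) := by
    rw [tendsto_iff_dist_tendsto_zero]
    refine squeeze_zero (fun _ => dist_nonneg) (fun m => ?_)
      (by simpa using h1.const_mul (L : ℝ))
    have e1 := lowerReg_le_lowerReg_add (L := L) hf (gridStep L m (gridSample L m x)) x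
    have e2 := lowerReg_le_lowerReg_add (L := L) hf x (gridStep L m (gridSample L m x))
    have e3 : pathDist L (gridStep L m (gridSample L m x)) x =
      pathDist L x (gridStep L m (gridSample L m x)) := by simp only [pathDist, dist_comm]
    rw [e3] at e1
    rw [Real.dist_eq, abs_le]
    constructor <;> linarith
  have h3 : Tendsto (fun m => min 1 (gridOsc L m (gridSample L m x))) atTop (𝓝 (min 1 0)) :=
    tendsto_const_nhds.min (tendsto_gridOsc_gridSample hx L)
  simpa [gridMinorant] using h2.sub (h3.const_mul (L : ℝ))

end LowerReg

/-! ### Consequences of convergence in law -/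

section Distribution

variable {E : Type*} {Ω : ℕ → Type*} {Ω' : Type*} [∀ n, MeasurableSpace (Ω n)]
  [MeasurableSpace Ω'] {P : ∀ n, Measure (Ω n)} [∀ n, IsProbabilityMeasure (P n)]
  {P' : Measure Ω'} [IsProbabilityMeasure P']

theorem MeasureTheory.TendstoInDistribution.tendsto_integral_comp [TopologicalSpace E]
    [MeasurableSpace E] [OpensMeasurableSpace E] {X : ∀ n, Ω n → E} {Z : Ω' → E}
    (h : TendstoInDistribution X atTop Z P P') {g : E → ℝ} (hg : Continuous g) {C : ℝ}
    (hC : ∀ v, |g v| ≤ C) :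
    Tendsto (fun n => ∫ ω, g (X n ω) ∂(P n)) atTop (𝓝 (∫ ω, g (Z ω) ∂P')) := by
  have := ProbabilityMeasure.tendsto_iff_forall_integral_tendsto.1 h.tendsto
    (BoundedContinuousFunction.ofNormedAddCommGroup g hg C hC)
  simp only [BoundedContinuousFunction.coe_ofNormedAddCommGroup, ProbabilityMeasure.coe_mk] at this
  rw [integral_map h.aemeasurable_limit hg.measurable.aestronglyMeasurable] at this
  refine this.congr fun n => ?_
  rw [integral_map (h.forall_aemeasurable n) hg.measurable.aestronglyMeasurable]

theorem MeasureTheory.TendstoInDistribution.limsup_measure_ge_le {X : ∀ n, Ω n → ℝ} {Z : Ω' → ℝ}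
    (h : TendstoInDistribution X atTop Z P P') (c : ℝ) :
    limsup (fun n => P n {ω | c ≤ X n ω}) atTop ≤ P' {ω | c ≤ Z ω} := by
  have := ProbabilityMeasure.limsup_measure_closed_le_of_tendsto h.tendsto
    (isClosed_Ici (a := c))
  simp only [ProbabilityMeasure.coe_mk] at this
  rw [Measure.map_apply_of_aemeasurable h.aemeasurable_limit measurableSet_Ici] at this
  refine le_trans (le_of_eq (limsup_congr (.of_forall fun n => ?_))) this
  rw [Measure.map_apply_of_aemeasurable (h.forall_aemeasurable n) measurableSet_Ici]
  rfl

theorem tendsto_measure_ge_atTop {Z : Ω' → ℝ} (hZ : AEMeasurable Z P') :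
    Tendsto (fun K : ℝ => P' {ω | K ≤ Z ω}) atTop (𝓝 0) := by
  have h := tendsto_measure_iInter_atTop (μ := P') (s := fun K : ℝ => {ω | K ≤ Z ω})
    (fun K => nullMeasurableSet_le aemeasurable_const hZ)
    (fun a b hab ω hω => le_trans hab hω) ⟨0, measure_ne_top _ _⟩
  have he : ⋂ K : ℝ, {ω | K ≤ Z ω} = ∅ := by
    refine Set.eq_empty_of_forall_notMem fun ω hω => ?_
    have : Z ω + 1 ≤ Z ω := Set.mem_iInter.1 hω (Z ω + 1)
    linarith
  rwa [he, measure_empty] at h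

/-- A sequence of real random variables which converges in distribution is tight from above. -/
theorem MeasureTheory.TendstoInDistribution.exists_forall_measure_gt_le {X : ∀ n, Ω n → ℝ}
    {Z : Ω' → ℝ} (h : TendstoInDistribution X atTop Z P P') {η : ℝ≥0∞} (hη : 0 < η) :
    ∃ K : ℝ, ∀ n, P n {ω | K ≤ X n ω} ≤ η := by
  obtain ⟨K₀, hK₀⟩ :=
    ((tendsto_measure_ge_atTop h.aemeasurable_limit).eventually_lt_const hη).exists
  obtain ⟨N, hN⟩ := eventually_atTop.1
    (eventually_lt_of_limsup_lt ((h.limsup_measure_ge_le K₀).trans_lt hK₀))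
  -- The limsup bound covers only `n ≥ N`; each of the finitely many remaining variables is tight by
  -- itself.
  choose K hK using fun n =>
    ((tendsto_measure_ge_atTop (h.forall_aemeasurable n)).eventually_lt_const hη).exists
  obtain ⟨B, hB⟩ := ((Finset.range N).image K).bddAbove
  refine ⟨max K₀ B, fun n => ?_⟩
  by_cases hn : N ≤ n
  · have hsub : {ω | max K₀ B ≤ X n ω} ⊆ {ω | K₀ ≤ X n ω} :=
      fun ω hω => (le_max_left K₀ B).trans hω
    exact (measure_mono hsub).trans (hN n hn).le
  · have hKB : K n ≤ max K₀ B :=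
      (hB (by simpa using ⟨n, not_le.1 hn, rfl⟩)).trans (le_max_right _ _)
    have hsub : {ω | max K₀ B ≤ X n ω} ⊆ {ω | K n ≤ X n ω} := fun ω hω => hKB.trans hω
    exact (measure_mono hsub).trans (hK n).le

end Distribution

/-! ### Tightness and weak convergence -/

section Main

variable {d : ℕ} {Ω : ℕ → Type*} {Ω' : Type*} [∀ n, MeasurableSpace (Ω n)]
  [MeasurableSpace Ω'] {P : ∀ n, Measure (Ω n)} [∀ n, IsProbabilityMeasure (P n)]
  {P' : Measure Ω'} [IsProbabilityMeasure P']
  {A : ∀ n, Ω n → SkorokhodSpace d} {A' : Ω' → SkorokhodSpace d}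

theorem FDDConverges.tendstoInDistribution_gridSample (hfdd : FDDConverges P P' A A') (L m : ℕ) :
    TendstoInDistribution (fun n ω => gridSample L m (A n ω)) atTop
      (fun ω => gridSample L m (A' ω)) P P' :=
  hfdd (gridSize L m + 1) fun j => gridTime m j

theorem FDDConverges.tendstoInDistribution_gridOsc (hfdd : FDDConverges P P' A A') (L m : ℕ) :
    TendstoInDistribution (fun n ω => gridOsc L m (gridSample L m (A n ω))) atTop
      (fun ω => gridOsc L m (gridSample L m (A' ω))) P P' :=
  (hfdd.tendstoInDistribution_gridSample L m).continuous_comp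
    (g := gridOsc L m) continuous_gridOsc

theorem FDDConverges.exists_forall_measure_norm_gt_le (hfdd : FDDConverges P P' A A')
    (hmono : ∀ n, ∀ᵐ ω ∂(P n), ∀ i : Fin d, Monotone fun t => A n ω t i)
    (T : ℝ≥0) {η : ℝ≥0∞} (hη : 0 < η) :
    ∃ K : ℝ, ∀ n, P n {ω | ∃ t ≤ T, K < ‖A n ω t‖} ≤ η := by
  -- By monotonicity this function of the values at 0 and `T` dominates the running maximum.
  have hc : Continuous fun v : Fin 2 → EuclideanSpace ℝ (Fin d) => ‖v 1 - v 0‖ + ‖v 0‖ := by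
    fun_prop
  obtain ⟨K, hK⟩ := ((hfdd 2 ![0, T]).continuous_comp hc).exists_forall_measure_gt_le hη
  refine ⟨K, fun n => (measure_mono_ae ?_).trans (hK n)⟩
  filter_upwards [hmono n] with ω hω
  rintro ⟨t, ht, hKt⟩
  exact hKt.le.trans (norm_le_of_monotone hω ht)

theorem FDDConverges.tendsto_limsup_modulusC (hfdd : FDDConverges P P' A A')
    (hmono : ∀ n, ∀ᵐ ω ∂(P n), ∀ i : Fin d, Monotone fun t => A n ω t i)
    (hcont : ∀ᵐ ω ∂P', Continuous (A' ω).toFun) (T : ℝ≥0) {ε : ℝ≥0∞} (hε : 0 < ε) :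
    Tendsto (fun δ : ℝ => limsup (fun n => P n {ω | ε ≤ (A n ω).modulusC δ T}) atTop)
      (𝓝[>] 0) (𝓝 0) := by
  obtain ⟨L, hL⟩ := exists_nat_ge T
  -- `ε` may be infinite, so a finite level below it is chosen; the 2 is that of the modulus bound.
  obtain ⟨c, hc0, hcε⟩ : ∃ c : ℝ, 0 < c ∧ ENNReal.ofReal (2 * c) ≤ ε := by
    obtain ⟨q, hq0, hq⟩ := ENNReal.lt_iff_exists_nnreal_btwn.1 hε
    refine ⟨q / 2, half_pos (by exact_mod_cast hq0), ?_⟩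
    rw [mul_div_cancel₀ _ two_ne_zero, ENNReal.ofReal_coe_nnreal]
    exact hq.le
  have hlim : Tendsto (fun m => P' {ω | c ≤ gridOsc L m (gridSample L m (A' ω))})
      atTop (𝓝 0) := by
    have h := tendstoInMeasure_of_tendsto_ae (μ := P')
      (f := fun m ω => gridOsc L m (gridSample L m (A' ω))) (g := fun _ => 0)
      (fun m => (hfdd.tendstoInDistribution_gridOsc L m).aemeasurable_limit.aestronglyMeasurable)
      (hcont.mono fun ω hω => tendsto_gridOsc_gridSample hω L)
    have := tendstoInMeasure_iff_dist.1 h c hc0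
    simpa [abs_of_nonneg (gridOsc_nonneg _)] using this
  rw [ENNReal.tendsto_nhds_zero]
  intro η hη
  -- The mesh is fixed using the limit process alone; only afterwards does `n → ∞`.
  obtain ⟨m, hm⟩ := (ENNReal.tendsto_nhds_zero.1 hlim η hη).exists
  filter_upwards [Ioo_mem_nhdsGT (show (0 : ℝ) < 1 / (m + 1) by positivity)] with δ hδ
  refine (limsup_le_limsup (.of_forall fun n => ?_)).trans
    (((hfdd.tendstoInDistribution_gridOsc L m).limsup_measure_ge_le c).trans hm)
  refine measure_mono_ae ?_
  filter_upwards [hmono n] with ω hω h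
  have h1 := (hcε.trans h).trans
    (modulusC_le_gridOsc_of_monotone (A n ω) hω hδ.2.le hL)
  rw [ENNReal.ofReal_le_ofReal_iff (mul_nonneg zero_le_two (gridOsc_nonneg _))] at h1
  exact le_of_mul_le_mul_left h1 two_pos

theorem FDDConverges.eventually_lt_integral (hfdd : FDDConverges P P' A A')
    (hA : ∀ n, Measurable (A n))
    (hmono : ∀ n, ∀ᵐ ω ∂(P n), ∀ i : Fin d, Monotone fun t => A n ω t i)
    (hcont : ∀ᵐ ω ∂P', Continuous (A' ω).toFun) {f : SkorokhodSpace d → ℝ} (hf : Measurable f)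
    (hfc : Continuous[SkorokhodSpace.cTopology d, _] f) {C : ℝ} (hC : ∀ x, |f x| ≤ C)
    {a : ℝ} (ha : a < ∫ ω, f (A' ω) ∂P') : ∀ᶠ n in atTop, a < ∫ ω, f (A n ω) ∂(P n) := by
  have hms (L m : ℕ) : AEStronglyMeasurable
      (fun ω => gridMinorant f L m (gridSample L m (A' ω))) P' :=
    ((continuous_gridMinorant hC L m).measurable.comp_aemeasurable
      (hfdd.tendstoInDistribution_gridSample L m).aemeasurable_limit).aestronglyMeasurable
  have hlim (L : ℕ) : ∀ᵐ ω ∂P', Tendsto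
      (fun m => gridMinorant f L m (gridSample L m (A' ω))) atTop
      (𝓝 (lowerReg f L (A' ω))) := hcont.mono fun ω hω => tendsto_gridMinorant hC L hω
  -- An infimum over uncountably many paths need not be measurable; along `A'` it is an almost sure
  -- limit of measurable minorants.
  have hreg (L : ℕ) : AEStronglyMeasurable (fun ω => lowerReg f L (A' ω)) P' :=
    aestronglyMeasurable_of_tendsto_ae atTop (hms L) (hlim L)
  obtain ⟨L, hL⟩ : ∃ L, a < ∫ ω, lowerReg f L (A' ω) ∂P' := by
    have : Tendsto (fun L => ∫ ω, lowerReg f L (A' ω) ∂P') atTop (𝓝 (∫ ω, f (A' ω) ∂P')) :=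
      tendsto_integral_of_dominated_convergence (fun _ => C) hreg (integrable_const _)
        (fun L => .of_forall fun ω => abs_lowerReg_coe_le hC _)
        (.of_forall fun ω => tendsto_lowerReg hC hfc _)
    exact (this.eventually_const_lt ha).exists
  obtain ⟨m, hm⟩ : ∃ m, a < ∫ ω, gridMinorant f L m (gridSample L m (A' ω)) ∂P' := by
    have := tendsto_integral_of_dominated_convergence (fun _ => C + L + L) (hms L)
      (integrable_const _) (fun m => .of_forall fun ω => abs_gridMinorant_le hC L m _) (hlim L)
    exact (this.eventually_const_lt hL).exists
  have hn := (hfdd.tendstoInDistribution_gridSample L m).tendsto_integral_comp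
    (continuous_gridMinorant hC L m) (abs_gridMinorant_le hC L m)
  filter_upwards [hn.eventually_const_lt hm] with n hn
  refine hn.trans_le (integral_mono_ae ?_ ?_ ?_)
  · exact .of_bound ((continuous_gridMinorant hC L m).measurable.comp_aemeasurable
      ((hfdd.tendstoInDistribution_gridSample L m).forall_aemeasurable n)).aestronglyMeasurable _
      (.of_forall fun ω => abs_gridMinorant_le hC L m _)
  · exact .of_bound (hf.comp (hA n)).aestronglyMeasurable C (.of_forall fun ω => hC _)
  · filter_upwards [hmono n] with ω hω
    exact gridMinorant_le_of_monotone hC L m _ hω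

theorem FDDConverges.weakConvergesC (hfdd : FDDConverges P P' A A')
    (hA : ∀ n, Measurable (A n))
    (hmono : ∀ n, ∀ᵐ ω ∂(P n), ∀ i : Fin d, Monotone fun t => A n ω t i)
    (hcont : ∀ᵐ ω ∂P', Continuous (A' ω).toFun) : WeakConvergesC P P' A A' := by
  rintro f hf hfc ⟨C, hC⟩
  refine tendsto_order.2 ⟨fun a ha =>
    hfdd.eventually_lt_integral hA hmono hcont hf hfc hC ha, fun a ha => ?_⟩
  have hfc' : Continuous[SkorokhodSpace.cTopology d, _] fun x => -f x := by
    let _ := SkorokhodSpace.cTopology d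
    exact hfc.neg
  have := hfdd.eventually_lt_integral hA hmono hcont hf.neg hfc' (C := C) (a := -a)
    (by simpa using hC) (by simpa [integral_neg] using ha)
  simpa [integral_neg] using this

/-- A `J₁`-continuous functional is Borel and also continuous for the finer `C`-topology. -/
theorem WeakConvergesC.tendstoInDistribution (h : WeakConvergesC P P' A A')
    (hA : ∀ n, Measurable (A n)) (hA' : Measurable A') :
    TendstoInDistribution A atTop A' P P' where
  forall_aemeasurable n := (hA n).aemeasurable
  aemeasurable_limit := hA'.aemeasurable
  tendsto := by
    refine ProbabilityMeasure.tendsto_iff_forall_integral_tendsto.2 fun f => ?_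
    have hf : Measurable f := f.continuous.measurable
    simp only [ProbabilityMeasure.coe_mk]
    rw [integral_map hA'.aemeasurable hf.aestronglyMeasurable]
    simp_rw [fun n => integral_map (hA n).aemeasurable (hf.aestronglyMeasurable)]
    exact h f hf (continuous_le_dom SkorokhodSpace.cTopology_le f.continuous)
      ⟨‖f‖, fun x => f.norm_coe_le_norm x⟩

end Main

theorem mainTheorem7 {d : ℕ} {Ω : ℕ → Type*} {Ω' : Type*} [∀ n, MeasurableSpace (Ω n)]
    [MeasurableSpace Ω'] (P : ∀ n, Measure (Ω n)) [∀ n, IsProbabilityMeasure (P n)]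
    (P' : Measure Ω') [IsProbabilityMeasure P']
    (A : ∀ n, Ω n → SkorokhodSpace d) (A' : Ω' → SkorokhodSpace d)
    (hA : ∀ n, Measurable (A n)) (hA' : Measurable A')
    (hmono : ∀ n, ∀ᵐ ω ∂(P n), ∀ i : Fin d, Monotone fun t => A n ω t i)
    (hcont : ∀ᵐ ω ∂P', Continuous (A' ω).toFun)
    (hfdd : FDDConverges P P' A A') :
    CTight P A ∧ WeakConvergesC P P' A A' ∧ TendstoInDistribution A atTop A' P P' :=
  ⟨⟨fun T _ hη => hfdd.exists_forall_measure_norm_gt_le hmono T hη,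
      fun T _ hε => hfdd.tendsto_limsup_modulusC hmono hcont T hε⟩,
    hfdd.weakConvergesC hA hmono hcont,
    (hfdd.weakConvergesC hA hmono hcont).tendstoInDistribution hA hA'⟩
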